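/- Graphs are finite, have at least one vertex, and may have loops and multiple edges; $d_G(v)$ denotes the degree of the vertex $v$ in $G$, where each loop at $v$ counts twice. A graph is $k$-edge-connected if for every nonempty proper subset $A$ of its vertex set at least $k$ edges have exactly one end in $A$. A factor of $G$ is a spanning subgraph of $G$, and the complement of a factor $H$ in $G$ is the graph $G\setminus E(H)$ obtained from $G$ by deleting the edges of $H$. A graph is $m$-tree-connected if it contains $m$ pairwise edge-disjoint spanning trees. **Theorem.** Let $m$ and $m_0$ be nonnegative integers and let $G$ be a $(2m+2m_0)$-edge-connected graph. For each vertex $v$, let $L(v)$ be a set of integers with $L(v)\subseteq\{m,\ldots,d_G(v)-m_0\}$ and $$|L(v)|\ \ge\ \left\lceil \frac{d_G(v)}{2}\right\rceil+1 .$$ Then $G$ has an $m$-tree-connected factor $H$ such that $d_H(v)\in L(v)$ for every vertex $v$ and the complement $G\setminus E(H)$ is $m_0$-tree-connected. -/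

import Mathlib

namespace Graph

variable {α β : Type*}

/-- The degree of `v` in the multigraph `G`: every edge incident with `v` counts once, and
every loop at `v` counts once more, so that loops contribute two. -/
noncomputable def degree (G : Graph α β) (v : α) : ℕ :=
  {e | G.Inc e v}.ncard + {e | G.IsLoopAt e v}.ncard

/-- The edges of `G` with exactly one end in `A`. -/
def cut (G : Graph α β) (A : Set α) : Set β :=
  {e | ∃ x y, G.IsLink e x y ∧ x ∈ A ∧ y ∉ A}

/-- `G` is `k`-edge-connected: for every nonempty proper subset `A` of the vertex set, at least
`k` edges of `G` have exactly one end in `A`. -/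
def IsEdgeConnected (G : Graph α β) (k : ℕ) : Prop :=
  ∀ A : Set α, A ⊂ G.vertexSet → A.Nonempty → k ≤ (G.cut A).ncard

/-- `G` is connected: it has a vertex, and any two vertices are joined by a walk. -/
def IsConnected (G : Graph α β) : Prop :=
  G.vertexSet.Nonempty ∧
    ∀ x ∈ G.vertexSet, ∀ y ∈ G.vertexSet, Relation.ReflTransGen G.Adj x y

/-- `G` contains a cycle with `n + 1` distinct vertices `v 0, …, v n` and `n + 1` distinct edges,
`e i` joining `v i` to `v (i + 1)`, where the indices are taken cyclically (addition in
`Fin (n + 1)` wraps around). A loop is a cycle with `n = 0`, and two parallel edges form a cycle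
with `n = 1`. -/
def HasCycle (G : Graph α β) : Prop :=
  ∃ (n : ℕ) (v : Fin (n + 1) → α) (e : Fin (n + 1) → β),
    Function.Injective v ∧ Function.Injective e ∧ ∀ i, G.IsLink (e i) (v i) (v (i + 1))

/-- A tree is a connected graph without cycles. -/
def IsTree (G : Graph α β) : Prop :=
  G.IsConnected ∧ ¬ G.HasCycle

/-- `G` is `m`-tree-connected: it contains `m` pairwise edge-disjoint spanning trees. -/
def IsTreeConnected (G : Graph α β) (m : ℕ) : Prop :=
  ∃ T : Fin m → Graph α β,
    (∀ i, (T i).IsSpanningSubgraph G ∧ (T i).IsTree) ∧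
    ∀ i j, i ≠ j → Disjoint (T i).edgeSet (T j).edgeSet

end Graph

/-!
The graph is oriented so that the lists can be handled by counting entering arcs.

Put `k = m + m₀` and fix a root `r`. A `2k`-edge-connected graph has an orientation in which every
vertex `v` receives at least `⌊d(v) / 2⌋` arcs and every nonempty vertex set avoiding `r` is entered
by at least `k` arcs. For given in-degrees `o` the number of arcs entering `X` is `o(X) - i(X)`,
where `i(X)` counts the edges inside `X`, so this is a statement about `o` alone. A prescription
of minimum sum on the vertices other than `r` satisfies it: every vertex above its lower bound
then lies in a tight set, and uncrossing tight sets leaves enough edges for `r`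
(`exists_inDegree_prescription`). Hall's theorem turns the prescription into an orientation
(`exists_orientation`), and by Edmonds' theorem the orientation has `k` arc-disjoint spanning
arborescences rooted at `r` (`exists_disjoint_isArborescence`).

The union `T` of `m` of them is put into the factor and the union `T₀` of the other `m₀` into its
complement. On the remaining edges `R` any set `S` may be chosen, provided that
`d_S(v) + d_T(v) ∈ L(v)`. By the theorem of Frank, Lau and Szabó (`exists_endDeg_notMem`) this
is possible if at each `v` the number of forbidden values of `d_S(v)` is at most the in-degree of
`v` in `R`. As `L(v) ⊆ {m, …, d(v) - m₀}` and `|L(v)| ≥ ⌈d(v) / 2⌉ + 1`, at most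
`⌊d(v) / 2⌋ - m - m₀` values are forbidden at `v ≠ r` (`card_forbidden_add_le`), whereas each
arborescence uses exactly one arc entering `v`, which leaves at least that many arcs of `R`
entering `v`. At `r` the arborescences use no entering arc, and the bound holds as well.
-/

namespace EdgeEnds

open Finset

variable {α β : Type*} [DecidableEq α]

/-! ### Counting edges by their ends -/

/-- The edges of `E` with both ends in `X`, where the ends of `e` are `s e` and `t e`. -/
def inside (E : Finset β) (s t : β → α) (X : Finset α) : Finset β :=
  {e ∈ E | s e ∈ X ∧ t e ∈ X}

/-- The edges of `E` with exactly one end in `X`. -/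
def boundary (E : Finset β) (s t : β → α) (X : Finset α) : Finset β :=
  {e ∈ E | ¬ (s e ∈ X ↔ t e ∈ X)}

/-- The edges of `E` with at least one end in `X`. -/
def touching (E : Finset β) (s t : β → α) (X : Finset α) : Finset β :=
  {e ∈ E | s e ∈ X ∨ t e ∈ X}

/-- The number of edges of `E` whose second end is `v`: the in-degree of `v` when each edge `e` is
directed towards `t e`. -/
def inDeg (E : Finset β) (t : β → α) (v : α) : ℕ :=
  #{e ∈ E | t e = v}

/-- The number of ends of edges of `E` at `v`, so that loops count twice. -/
def endDeg (E : Finset β) (s t : β → α) (v : α) : ℕ :=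
  inDeg E s v + inDeg E t v

lemma endDeg_mono {E F : Finset β} (h : E ⊆ F) (a b : β → α) (v : α) :
    endDeg E a b v ≤ endDeg F a b v :=
  add_le_add (card_le_card (filter_subset_filter _ h)) (card_le_card (filter_subset_filter _ h))

lemma sum_inDeg (E : Finset β) (t : β → α) (X : Finset α) :
    ∑ v ∈ X, inDeg E t v = #{e ∈ E | t e ∈ X} := by
  rw [card_eq_sum_card_fiberwise (f := t) (t := X) (by intro e; simp)]
  refine sum_congr rfl fun v hv ↦ ?_
  rw [inDeg, filter_filter]
  congr 1
  ext e
  simp only [mem_filter]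
  grind

lemma sum_endDeg (E : Finset β) (s t : β → α) (X : Finset α) :
    ∑ v ∈ X, endDeg E s t v = 2 * #(inside E s t X) + #(boundary E s t X) := by
  simp only [endDeg, sum_add_distrib, sum_inDeg, inside, boundary, card_filter, mul_sum]
  rw [← sum_add_distrib, ← sum_add_distrib]
  refine sum_congr rfl fun e _ ↦ ?_
  by_cases h₁ : s e ∈ X <;> by_cases h₂ : t e ∈ X <;> simp [h₁, h₂]

lemma sum_endDeg_le_two_mul_card_touching (E : Finset β) (s t : β → α) (X : Finset α) :
    ∑ v ∈ X, endDeg E s t v ≤ 2 * #(touching E s t X) := by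
  simp only [endDeg, sum_add_distrib, sum_inDeg, touching, card_filter, mul_sum]
  rw [← sum_add_distrib]
  refine sum_le_sum fun e _ ↦ ?_
  by_cases h₁ : s e ∈ X <;> by_cases h₂ : t e ∈ X <;> simp [h₁, h₂]

lemma card_inside_add_card_inside_le (E : Finset β) (s t : β → α) (X Y : Finset α) :
    #(inside E s t X) + #(inside E s t Y) ≤
      #(inside E s t (X ∪ Y)) + #(inside E s t (X ∩ Y)) := by
  simp only [inside, card_filter]
  rw [← sum_add_distrib, ← sum_add_distrib]
  refine sum_le_sum fun e _ ↦ ?_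
  by_cases h₁ : s e ∈ X <;> by_cases h₂ : t e ∈ X <;> by_cases h₃ : s e ∈ Y <;>
    by_cases h₄ : t e ∈ Y <;> simp [h₁, h₂, h₃, h₄]

lemma card_touching_sdiff_add_card_inside_le (E : Finset β) (s t : β → α) (Y Z : Finset α) :
    #(touching E s t (Z \ Y)) + #(inside E s t Y) ≤
      #(touching E s t Z) + #(inside E s t (Y \ Z)) := by
  simp only [inside, touching, card_filter]
  rw [← sum_add_distrib, ← sum_add_distrib]
  refine sum_le_sum fun e _ ↦ ?_
  by_cases h₁ : s e ∈ Z <;> by_cases h₂ : t e ∈ Z <;> by_cases h₃ : s e ∈ Y <;>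
    by_cases h₄ : t e ∈ Y <;> simp [h₁, h₂, h₃, h₄]

lemma card_inside_sdiff_add_card_touching {E : Finset β} {s t : β → α} {V : Finset α}
    (hs : ∀ e ∈ E, s e ∈ V) (ht : ∀ e ∈ E, t e ∈ V) (X : Finset α) :
    #(inside E s t (V \ X)) + #(touching E s t X) = #E := by
  simp only [inside, touching, card_filter]
  rw [← sum_add_distrib, card_eq_sum_ones]
  refine sum_congr rfl fun e he ↦ ?_
  by_cases h₁ : s e ∈ X <;> by_cases h₂ : t e ∈ X <;> simp [h₁, h₂, hs e he, ht e he]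

/-! ### Choosing the in-degrees -/

/-- `X` is tight for the in-degree prescription `o` if an orientation with in-degrees `o` has
exactly `k` arcs entering `X`. -/
def Tight (E : Finset β) (s t : β → α) (k : ℕ) (o : α → ℕ) (X : Finset α) : Prop :=
  ∑ v ∈ X, o v = #(inside E s t X) + k

section

variable {E : Finset β} {s t : β → α} {k : ℕ} {o : α → ℕ} {W : Finset α}

lemma Tight.union {X Y : Finset α}
    (ho : ∀ X ⊆ W, X.Nonempty → #(inside E s t X) + k ≤ ∑ v ∈ X, o v)
    (hXW : X ⊆ W) (hYW : Y ⊆ W) (hX : Tight E s t k o X) (hY : Tight E s t k o Y)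
    (hXY : (X ∩ Y).Nonempty) : Tight E s t k o (X ∪ Y) := by
  have h₁ := ho _ (union_subset hXW hYW) (hXY.mono (inter_subset_left.trans subset_union_left))
  have h₂ := ho _ (inter_subset_left.trans hXW) hXY
  have h₃ := card_inside_add_card_inside_le E s t X Y
  have h₄ := sum_union_inter (s₁ := X) (s₂ := Y) (f := o)
  unfold Tight at *
  omega

/-- If every tight set meeting `Z` lies inside `Z`, then the maximal tight subsets of `Z` are
disjoint and cover all vertices of `Z` with `o v > d(v) / 2`. The bound therefore holds on `Z`,
since each tight set `Y` has `2 o(Y) = 2 i(Y) + 2 k ≤ d(Y)`. -/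
lemma two_mul_sum_le_sum_endDeg
    (ho : ∀ X ⊆ W, X.Nonempty → #(inside E s t X) + k ≤ ∑ v ∈ X, o v)
    (hcut : ∀ X ⊆ W, X.Nonempty → 2 * k ≤ #(boundary E s t X))
    (hcov : ∀ v ∈ W, endDeg E s t v / 2 < o v → ∃ X ⊆ W, v ∈ X ∧ Tight E s t k o X)
    (Z : Finset α) (hZW : Z ⊆ W)
    (hZ : ∀ Y ⊆ W, Tight E s t k o Y → (Y ∩ Z).Nonempty → Y ⊆ Z) :
    2 * ∑ v ∈ Z, o v ≤ ∑ v ∈ Z, endDeg E s t v := by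
  induction Z using Finset.strongInduction with
  | H Z ih =>
    by_cases hbig : ∃ v ∈ Z, endDeg E s t v / 2 < o v
    · obtain ⟨v, hvZ, hv⟩ := hbig
      obtain ⟨X, hXW, hvX, hX⟩ := hcov v (hZW hvZ) hv
      -- A maximal tight subset of `Z` containing `v` is disjoint from all other tight sets.
      have hfin : {Y | Y ⊆ W ∧ Tight E s t k o Y}.Finite :=
        W.powerset.finite_toSet.subset fun Y hY ↦ mem_coe.2 (mem_powerset.2 hY.1)
      obtain ⟨Y, hXY, hY⟩ := hfin.exists_le_maximal (a := X) ⟨hXW, hX⟩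
      obtain ⟨hYW, hYt⟩ := hY.prop
      have hvY : v ∈ Y := hXY hvX
      have hYZ : Y ⊆ Z := hZ Y hYW hYt ⟨v, by simp [hvY, hvZ]⟩
      have hlt : Z \ Y ⊂ Z := sdiff_ssubset hYZ ⟨v, hvY⟩
      have hrec := ih (Z \ Y) hlt (sdiff_subset.trans hZW) fun Y' hY'W hY't hne ↦ by
        have hY'Z : Y' ⊆ Z := hZ Y' hY'W hY't (hne.mono (by gcongr))
        intro u hu
        refine mem_sdiff.2 ⟨hY'Z hu, fun huY ↦ ?_⟩
        have hun := Tight.union ho hYW hY'W hYt hY't ⟨u, by simp [hu, huY]⟩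
        have hle := hY.le_of_ge (y := Y ∪ Y')
          ⟨union_subset hYW hY'W, hun⟩ subset_union_left
        obtain ⟨w, hw⟩ := hne
        simp only [mem_inter, mem_sdiff] at hw
        exact hw.2.2 (hle (mem_union_right _ hw.1))
      have h₁ := sum_sdiff hYZ (f := o)
      have h₂ := sum_sdiff hYZ (f := endDeg E s t)
      have h₃ := sum_endDeg E s t Y
      have h₄ := hcut Y hYW ⟨v, hvY⟩
      unfold Tight at hYt
      omega
    · push Not at hbig
      rw [mul_sum]
      refine sum_le_sum fun v hv ↦ ?_
      have := hbig v hv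
      omega

/-- The upper bounds on in-degrees that an orientation needs hold as well: tight sets crossing
`Z` are split off one at a time, until the bound by half the degree sum applies. -/
lemma sum_le_card_touching
    (ho : ∀ X ⊆ W, X.Nonempty → #(inside E s t X) + k ≤ ∑ v ∈ X, o v)
    (hcut : ∀ X ⊆ W, X.Nonempty → 2 * k ≤ #(boundary E s t X))
    (hcov : ∀ v ∈ W, endDeg E s t v / 2 < o v → ∃ X ⊆ W, v ∈ X ∧ Tight E s t k o X)
    (Z : Finset α) (hZW : Z ⊆ W) :
    ∑ v ∈ Z, o v ≤ #(touching E s t Z) := by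
  induction Z using Finset.strongInduction with
  | H Z ih =>
    by_cases hZ : ∀ Y ⊆ W, Tight E s t k o Y → (Y ∩ Z).Nonempty → Y ⊆ Z
    · have h₁ := two_mul_sum_le_sum_endDeg ho hcut hcov Z hZW hZ
      have h₂ := sum_endDeg_le_two_mul_card_touching E s t Z
      omega
    · push Not at hZ
      obtain ⟨Y, hYW, hYt, ⟨u, hu⟩, hYZ⟩ := hZ
      simp only [mem_inter] at hu
      -- Here `o(Y ∩ Z) = o(Y) - o(Y \ Z) ≤ i(Y) - i(Y \ Z)`, which counts edges that touch `Z`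
      -- but not `Z \ Y`.
      have hlt : Z \ Y ⊂ Z := by
        refine Finset.ssubset_iff_subset_ne.2 ⟨sdiff_subset, fun h ↦ ?_⟩
        have := h ▸ hu.2
        exact (mem_sdiff.1 this).2 hu.1
      have h₀ := ih _ hlt (sdiff_subset.trans hZW)
      have h₁ := ho (Y \ Z) (sdiff_subset.trans hYW) (sdiff_nonempty.2 hYZ)
      have h₂ := card_touching_sdiff_add_card_inside_le E s t Y Z
      have h₃ := sum_inter_add_sum_sdiff Y Z o
      have h₄ := sum_inter_add_sum_sdiff Z Y o
      rw [inter_comm] at h₄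
      unfold Tight at hYt
      omega

end

/-- In-degrees for a rooted `k`-arc-connected orientation of a `2k`-edge-connected graph in which
every vertex receives at least half of its edges, rounded down. Among the prescriptions on
`V \ {r}` that satisfy the lower bounds, one of minimum sum is taken; the root receives the
remaining edges. -/
theorem exists_inDegree_prescription {V : Finset α} {E : Finset β} {s t : β → α}
    (hs : ∀ e ∈ E, s e ∈ V) (ht : ∀ e ∈ E, t e ∈ V) {k : ℕ} {r : α} (hr : r ∈ V)
    (hcut : ∀ X ⊆ V, X.Nonempty → X ≠ V → 2 * k ≤ #(boundary E s t X)) :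
    ∃ o : α → ℕ, (∀ v ∈ V, endDeg E s t v / 2 ≤ o v) ∧ ∑ v ∈ V, o v = #E ∧
      (∀ X ⊆ V, #(inside E s t X) ≤ ∑ v ∈ X, o v) ∧
      ∀ X ⊆ V, X.Nonempty → r ∉ X → #(inside E s t X) + k ≤ ∑ v ∈ X, o v := by
  set W := V.erase r with hW
  have hWV : W ⊆ V := erase_subset r V
  have hcutW : ∀ X ⊆ W, X.Nonempty → 2 * k ≤ #(boundary E s t X) := fun X hX hne ↦
    hcut X (hX.trans hWV) hne fun h ↦ by
      have := hX (h ▸ hr)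
      simp [hW] at this
  let S : Set (α → ℕ) := {o | (∀ v ∈ W, endDeg E s t v / 2 ≤ o v) ∧
    ∀ X ⊆ W, X.Nonempty → #(inside E s t X) + k ≤ ∑ v ∈ X, o v}
  have hS : S.Nonempty := by
    refine ⟨endDeg E s t, fun v _ ↦ Nat.div_le_self _ _, fun X hX hne ↦ ?_⟩
    have h₁ := sum_endDeg E s t X
    have h₂ := hcutW X hX hne
    omega
  obtain ⟨o, ⟨hodeg, ho⟩, hmin⟩ := WellFounded.has_min
    (measure fun o : α → ℕ ↦ ∑ v ∈ W, o v).wf S hS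
  have hcov : ∀ v ∈ W, endDeg E s t v / 2 < o v → ∃ X ⊆ W, v ∈ X ∧ Tight E s t k o X := by
    intro v hv hlt
    by_contra! hno
    have hsum : ∀ X : Finset α, v ∈ X →
        ∑ u ∈ X, Function.update o v (o v - 1) u + 1 = ∑ u ∈ X, o u := by
      intro X hvX
      rw [sum_update_of_mem hvX, ← add_sum_erase X o hvX, sdiff_singleton_eq_erase]
      omega
    refine hmin (Function.update o v (o v - 1)) ⟨fun u hu ↦ ?_, fun X hX hne ↦ ?_⟩ ?_
    · rcases eq_or_ne u v with rfl | huv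
      · simp only [Function.update_self]
        omega
      · simpa [huv] using hodeg u hu
    · by_cases hvX : v ∈ X
      · have h₁ := hsum X hvX
        have h₂ := ho X hX hne
        have h₃ := hno X hX hvX
        unfold Tight at h₃
        omega
      · rw [sum_update_of_notMem hvX]
        exact ho X hX hne
    · have := hsum W hv
      change ∑ u ∈ W, Function.update o v (o v - 1) u < ∑ u ∈ W, o u
      omega
  have hhalf := two_mul_sum_le_sum_endDeg ho hcutW hcov W Subset.rfl fun Y hY _ _ ↦ hY
  have htouch := sum_le_card_touching ho hcutW hcov
  have hVsum : ∑ v ∈ V, endDeg E s t v = 2 * #E := by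
    have h₁ : inside E s t V = E := filter_true_of_mem fun e he ↦ ⟨hs e he, ht e he⟩
    have h₂ : boundary E s t V = ∅ :=
      filter_false_of_mem fun e he ↦ by simp [hs e he, ht e he]
    rw [sum_endDeg, h₁, h₂]
    simp
  have hWsum := add_sum_erase V (endDeg E s t) hr
  rw [← hW] at hWsum
  have hagree : ∀ X : Finset α, r ∉ X → ∀ c,
      ∑ v ∈ X, Function.update o r c v = ∑ v ∈ X, o v :=
    fun X hX c ↦ sum_update_of_notMem hX _ _
  set c := #E - ∑ v ∈ W, o v with hc
  have hVtot : ∑ v ∈ V, Function.update o r c v = #E := by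
    rw [← add_sum_erase V _ hr, hagree _ (notMem_erase r V), Function.update_self, ← hW]
    omega
  have hroot : ∀ X ⊆ V, X.Nonempty → r ∉ X →
      #(inside E s t X) + k ≤ ∑ v ∈ X, Function.update o r c v := fun X hX hne hrX ↦ by
    rw [hagree X hrX]
    exact ho X (subset_erase.2 ⟨hX, hrX⟩) hne
  refine ⟨Function.update o r c, fun v hv ↦ ?_, hVtot, fun X hX ↦ ?_, hroot⟩
  · rcases eq_or_ne v r with rfl | hvr
    · rw [Function.update_self]
      omega
    · rw [Function.update_of_ne hvr]
      exact hodeg v (mem_erase.2 ⟨hvr, hv⟩)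
  · by_cases hrX : r ∈ X
    · -- The bound for `X` is the bound on the number of edges touching `V \ X`.
      have h₁ := htouch (V \ X) fun v hv ↦ by
        rw [mem_sdiff] at hv
        exact mem_erase.2 ⟨fun h ↦ hv.2 (h ▸ hrX), hv.1⟩
      have h₂ := card_inside_sdiff_add_card_touching hs ht (V \ X)
      have h₃ := sum_sdiff hX (f := Function.update o r c)
      rw [Finset.sdiff_sdiff_eq_self hX] at h₂
      rw [hagree (V \ X) (by simp [hrX])] at h₃
      omega
    · rcases X.eq_empty_or_nonempty with rfl | hne
      · simp [inside]
      · exact (Nat.le_add_right _ _).trans (hroot X hX hne hrX)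

/-! ### Orientations with prescribed in-degrees -/

/-- Hakimi's theorem, obtained from Hall's theorem by matching each edge with one of `o v` places
at one of its ends `v`. -/
theorem exists_orientation {V : Finset α} {E : Finset β} {s t : β → α}
    (hs : ∀ e ∈ E, s e ∈ V) (ht : ∀ e ∈ E, t e ∈ V) {o : α → ℕ}
    (hsum : ∑ v ∈ V, o v = #E) (hle : ∀ X ⊆ V, #(inside E s t X) ≤ ∑ v ∈ X, o v) :
    ∃ a b : β → α, (∀ e, (a e = s e ∧ b e = t e) ∨ (a e = t e ∧ b e = s e)) ∧
      ∀ v ∈ V, inDeg E b v = o v := by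
  classical
  let places : {e // e ∈ E} → Finset (Σ _ : α, ℕ) := fun e ↦
    ({s e.1, t e.1} : Finset α).sigma fun v ↦ range (o v)
  obtain ⟨f, hf, hfp⟩ := (Finset.all_card_le_biUnion_card_iff_exists_injective places).1 <| by
    intro A
    set X : Finset α := A.biUnion fun e ↦ {s e.1, t e.1} with hX
    have hXV : X ⊆ V := by
      intro v hv
      simp only [hX, mem_biUnion, mem_insert, mem_singleton] at hv
      obtain ⟨e, -, rfl | rfl⟩ := hv
      exacts [hs _ e.2, ht _ e.2]
    have h₁ : #A ≤ #(inside E s t X) := by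
      rw [← card_map (Function.Embedding.subtype _)]
      refine card_le_card fun e he ↦ ?_
      simp only [mem_map, Function.Embedding.coe_subtype] at he
      obtain ⟨e, he, rfl⟩ := he
      simp only [inside, mem_filter, hX, mem_biUnion, mem_insert, mem_singleton]
      exact ⟨e.2, ⟨e, he, .inl rfl⟩, ⟨e, he, .inr rfl⟩⟩
    have h₂ : X.sigma (fun v ↦ range (o v)) ⊆ A.biUnion places := by
      rintro ⟨v, j⟩ hv
      simp only [hX, mem_sigma, mem_biUnion, mem_insert, mem_singleton, mem_range] at hv
      obtain ⟨⟨e, he, hve⟩, hj⟩ := hv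
      simp only [mem_biUnion, places, mem_sigma, mem_insert, mem_singleton, mem_range]
      exact ⟨e, he, hve, hj⟩
    calc #A ≤ ∑ v ∈ X, o v := h₁.trans (hle X hXV)
      _ = #(X.sigma fun v ↦ range (o v)) := by simp
      _ ≤ _ := card_le_card h₂
  let b : β → α := fun e ↦ if h : e ∈ E then (f ⟨e, h⟩).1 else t e
  have hb : ∀ e, b e = s e ∨ b e = t e := by
    intro e
    by_cases h : e ∈ E
    · have := hfp ⟨e, h⟩
      simp only [places, mem_sigma, mem_insert, mem_singleton] at this
      simpa [b, h] using this.1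
    · simp [b, h]
  have hbV : ∀ e ∈ E, b e ∈ V := fun e he ↦ by
    rcases hb e with h | h <;> rw [h]
    exacts [hs e he, ht e he]
  have hbo : ∀ v ∈ V, inDeg E b v ≤ o v := by
    intro v _
    rw [← card_range (o v), inDeg]
    refine card_le_card_of_injOn (fun e ↦ if h : e ∈ E then (f ⟨e, h⟩).2 else 0) ?_ ?_
    · intro e he
      simp only [coe_filter, Set.mem_ofPred_eq, b] at he
      obtain ⟨he, hev⟩ := he
      have := hfp ⟨e, he⟩
      simp only [places, mem_sigma] at this
      simp only [he, dif_pos] at hev ⊢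
      rw [← hev]
      exact_mod_cast this.2
    · intro e he e' he' hee
      simp only [coe_filter, Set.mem_ofPred_eq, b] at he he'
      obtain ⟨he, hev⟩ := he
      obtain ⟨he', hev'⟩ := he'
      simp only [he, he', dif_pos] at hev hev' hee
      have := hf (Sigma.ext (hev.trans hev'.symm) (heq_of_eq hee))
      exact congrArg Subtype.val this
  -- The in-degrees and the prescription have the same sum, so the inequalities are equalities.
  have hbsum : ∑ v ∈ V, inDeg E b v = ∑ v ∈ V, o v := by
    rw [sum_inDeg, hsum, filter_true_of_mem hbV]
  refine ⟨fun e ↦ if b e = t e then s e else t e, b, fun e ↦ ?_,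
    (sum_eq_sum_iff_of_le hbo).1 hbsum⟩
  rcases hb e with h | h
  · by_cases h' : b e = t e
    · exact .inl ⟨if_pos h', h'⟩
    · exact .inr ⟨if_neg h', h⟩
  · exact .inl ⟨if_pos h, h⟩

/-! ### Arc-disjoint spanning arborescences -/

/-- The arcs of `E` entering `X`, where the arc `e` leads from `a e` to `b e`. -/
def entering (E : Finset β) (a b : β → α) (X : Finset α) : Finset β :=
  {e ∈ E | b e ∈ X ∧ a e ∉ X}

lemma sum_inDeg_eq_card_inside_add_card_entering (E : Finset β) (a b : β → α) (X : Finset α) :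
    ∑ v ∈ X, inDeg E b v = #(inside E a b X) + #(entering E a b X) := by
  simp only [sum_inDeg, inside, entering, card_filter]
  rw [← sum_add_distrib]
  refine sum_congr rfl fun e _ ↦ ?_
  by_cases h₁ : a e ∈ X <;> by_cases h₂ : b e ∈ X <;> simp [h₁, h₂]

lemma card_entering_inter_add_card_entering_union_le (E : Finset β) (a b : β → α)
    (X Y : Finset α) :
    #(entering E a b (X ∩ Y)) + #(entering E a b (X ∪ Y)) ≤
      #(entering E a b X) + #(entering E a b Y) := by
  simp only [entering, card_filter]
  rw [← sum_add_distrib, ← sum_add_distrib]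
  refine sum_le_sum fun e _ ↦ ?_
  by_cases h₁ : a e ∈ X <;> by_cases h₂ : b e ∈ X <;> by_cases h₃ : a e ∈ Y <;>
    by_cases h₄ : b e ∈ Y <;> simp [h₁, h₂, h₃, h₄]

variable [DecidableEq β]

/-- `IsArborescence a b r U F`: the arcs `F` form an arborescence with root `r` and vertex set `U`,
where the arc `e` leads from `a e` to `b e`. Arborescences are grown from the root by adding
one arc at a time, leading from an old vertex to a new one. -/
inductive IsArborescence (a b : β → α) (r : α) : Finset α → Finset β → Prop
  | root : IsArborescence a b r {r} ∅
  | grow {U : Finset α} {F : Finset β} {e : β} (h : IsArborescence a b r U F)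
      (ha : a e ∈ U) (hb : b e ∉ U) : IsArborescence a b r (insert (b e) U) (insert e F)

namespace IsArborescence

variable {a b : β → α} {r : α} {U : Finset α} {F : Finset β}

lemma root_mem (h : IsArborescence a b r U F) : r ∈ U := by
  induction h with
  | root => simp
  | grow _ _ _ ih => exact mem_insert_of_mem ih

lemma ends_mem (h : IsArborescence a b r U F) : ∀ e ∈ F, a e ∈ U ∧ b e ∈ U := by
  induction h with
  | root => simp
  | grow _ ha _ ih => grind

lemma inDeg_eq (h : IsArborescence a b r U F) (v : α) :
    inDeg F b v = if v ∈ U ∧ v ≠ r then 1 else 0 := by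
  induction h with
  | root => simp [inDeg]
  | @grow U F e h ha hb ih =>
    have heF : e ∉ F := fun he ↦ hb (h.ends_mem e he).2
    have hbr : b e ≠ r := fun hbr ↦ hb (hbr ▸ h.root_mem)
    unfold inDeg at ih ⊢
    rw [filter_insert]
    rcases eq_or_ne (b e) v with rfl | hv
    · rw [if_pos rfl, card_insert_of_notMem (by simp [heF]), ih]
      simp [hb, hbr]
    · rw [if_neg hv, ih]
      simp [hv.symm]

end IsArborescence

/-- Lovász's step in the proof of Edmonds' theorem: a spanning arborescence whose removal lowers
the rooted arc-connectivity by at most one. A partial arborescence on `U` is extended by an arc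
into an inclusion-minimal set that meets the complement of `U` and is entered by only `k` arcs. -/
theorem exists_isArborescence {V : Finset α} {E : Finset β} {a b : β → α} {r : α} {k : ℕ}
    (hr : r ∈ V) (ha : ∀ e ∈ E, a e ∈ V) (hb : ∀ e ∈ E, b e ∈ V)
    (hE : ∀ X ⊆ V, X.Nonempty → r ∉ X → k + 1 ≤ #(entering E a b X)) :
    ∃ F ⊆ E, IsArborescence a b r V F ∧
      ∀ X ⊆ V, X.Nonempty → r ∉ X → k ≤ #(entering (E \ F) a b X) := by
  let Good : Finset α → Finset β → Prop := fun U F ↦ F ⊆ E ∧ IsArborescence a b r U F ∧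
      ∀ X ⊆ V, X.Nonempty → r ∉ X → k ≤ #(entering (E \ F) a b X)
  have hfin : {U | U ⊆ V ∧ ∃ F, Good U F}.Finite :=
    V.powerset.finite_toSet.subset fun U hU ↦ mem_coe.2 (mem_powerset.2 hU.1)
  obtain ⟨U, -, hU⟩ := hfin.exists_le_maximal (a := {r}) ⟨singleton_subset_iff.2 hr, ∅,
    empty_subset E, .root, fun X hX hne hrX ↦ by
      rw [sdiff_empty]
      exact (Nat.le_succ k).trans (hE X hX hne hrX)⟩
  obtain ⟨hUV, F, hFE, hF, hk⟩ := hU.prop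
  by_cases hUeq : U = V
  · exact ⟨F, hFE, hUeq ▸ hF, hk⟩
  exfalso
  -- It suffices to find an arc leaving `U` whose removal destroys no cut.
  suffices h : ∃ e ∈ E, a e ∈ U ∧ b e ∉ U ∧ ∀ Y ⊆ V, r ∉ Y → b e ∈ Y → a e ∉ Y →
      k + 1 ≤ #(entering (E \ F) a b Y) by
    obtain ⟨e, heE, hae, hbe, hY⟩ := h
    have hle := hU.le_of_ge (y := insert (b e) U) ⟨insert_subset (hb e heE) hUV, insert e F,
      insert_subset heE hFE, hF.grow hae hbe, fun X hX hne hrX ↦ ?_⟩ (subset_insert _ _)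
    · exact hbe (hle (mem_insert_self _ _))
    have herase : entering (E \ insert e F) a b X = (entering (E \ F) a b X).erase e := by
      ext f
      simp only [entering, mem_filter, mem_sdiff, mem_insert, mem_erase]
      tauto
    rw [herase]
    by_cases he : e ∈ entering (E \ F) a b X
    · have hab := (mem_filter.1 he).2
      have h₁ := hY X hX hrX hab.1 hab.2
      have h₂ := pred_card_le_card_erase (s := entering (E \ F) a b X) (a := e)
      omega
    · rw [erase_eq_of_notMem he]
      exact hk X hX hne hrX
  have hFout : ∀ e, b e ∉ U → e ∉ F := fun e he heF ↦ he (hF.ends_mem e heF).2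
  have hrU := hF.root_mem
  by_cases hdanger : ∃ X, X ⊆ V ∧ r ∉ X ∧ (X \ U).Nonempty ∧ #(entering (E \ F) a b X) ≤ k
  · have hfin' : {X | X ⊆ V ∧ r ∉ X ∧ (X \ U).Nonempty ∧
        #(entering (E \ F) a b X) ≤ k}.Finite :=
      V.powerset.finite_toSet.subset fun X hX ↦ mem_coe.2 (mem_powerset.2 hX.1)
    obtain ⟨X, hX⟩ := hfin'.exists_minimal hdanger
    obtain ⟨hXV, hrX, hXU, hXk⟩ := hX.prop
    have hlt : #(entering (E \ F) a b X) < #(entering E a b (X \ U)) :=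
      Nat.lt_of_le_of_lt hXk (hE _ (sdiff_subset.trans hXV) hXU (by simp [hrX]))
    obtain ⟨e, he, he'⟩ := exists_mem_notMem_of_card_lt_card hlt
    simp only [entering, mem_filter, mem_sdiff] at he he'
    obtain ⟨heE, ⟨hbX, hbU⟩, haXU⟩ := he
    have heF := hFout e hbU
    have haX : a e ∈ X := by tauto
    have haU : a e ∈ U := by tauto
    refine ⟨e, heE, haU, hbU, fun Y hYV hrY hbY haY ↦ ?_⟩
    by_contra! hYk
    have h₁ := card_entering_inter_add_card_entering_union_le (E \ F) a b X Y
    have h₂ := hk (X ∪ Y) (union_subset hXV hYV) ⟨b e, by simp [hbX]⟩ (by simp [hrX, hrY])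
    have hle := hX.le_of_le (y := X ∩ Y) ⟨inter_subset_left.trans hXV, by simp [hrX],
      ⟨b e, by simp [hbX, hbY, hbU]⟩, by omega⟩ inter_subset_left
    exact haY (mem_inter.1 (hle haX)).2
  · push Not at hdanger
    have hne : (V \ U).Nonempty := sdiff_nonempty.2 fun h ↦ hUeq (hUV.antisymm h)
    have hpos : 0 < #(entering E a b (V \ U)) :=
      (Nat.succ_pos k).trans_le (hE _ sdiff_subset hne (by simp [hrU]))
    obtain ⟨e, he⟩ := card_pos.1 hpos
    simp only [entering, mem_filter, mem_sdiff] at he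
    obtain ⟨heE, ⟨hbV, hbU⟩, haU⟩ := he
    have haU : a e ∈ U := by
      have := ha e heE
      tauto
    exact ⟨e, heE, haU, hbU, fun Y hYV hrY hbY _ ↦
      hdanger Y hYV hrY ⟨b e, by simp [hbY, hbU]⟩⟩

/-- Edmonds' theorem on arc-disjoint spanning arborescences with a common root. -/
theorem exists_disjoint_isArborescence {V : Finset α} {a b : β → α} {r : α} (hr : r ∈ V) (k : ℕ)
    {E : Finset β} (ha : ∀ e ∈ E, a e ∈ V) (hb : ∀ e ∈ E, b e ∈ V)
    (hE : ∀ X ⊆ V, X.Nonempty → r ∉ X → k ≤ #(entering E a b X)) :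
    ∃ F : Fin k → Finset β, (∀ i, F i ⊆ E) ∧ Pairwise (fun i j ↦ Disjoint (F i) (F j)) ∧
      ∀ i, IsArborescence a b r V (F i) := by
  induction k generalizing E with
  | zero => exact ⟨Fin.elim0, fun i ↦ i.elim0, fun i ↦ i.elim0, fun i ↦ i.elim0⟩
  | succ k ih =>
    obtain ⟨F₀, hF₀E, hF₀, hk⟩ := exists_isArborescence hr ha hb hE
    obtain ⟨F, hFE, hFd, hF⟩ := ih (E := E \ F₀) (fun e he ↦ ha e (mem_sdiff.1 he).1)
      (fun e he ↦ hb e (mem_sdiff.1 he).1) hk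
    have hd : ∀ i, Disjoint F₀ (F i) := fun i ↦ disjoint_sdiff.mono_right (hFE i)
    refine ⟨Fin.cons F₀ F, fun i ↦ ?_, fun i j hij ↦ ?_, fun i ↦ ?_⟩
    · cases i using Fin.cases with
      | zero => exact hF₀E
      | succ i => exact (hFE i).trans sdiff_subset
    · cases i using Fin.cases with
      | zero =>
        cases j using Fin.cases with
        | zero => exact absurd rfl hij
        | succ j => exact hd j
      | succ i =>
        cases j using Fin.cases with
        | zero => exact (hd i).symm
        | succ j => exact hFd fun h ↦ hij (congrArg _ h)
    · cases i using Fin.cases with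
      | zero => exact hF₀
      | succ i => exact hF i

/-! ### Factors avoiding forbidden degrees -/

lemma inDeg_union {E F : Finset β} (h : Disjoint E F) (b : β → α) (v : α) :
    inDeg (E ∪ F) b v = inDeg E b v + inDeg F b v := by
  rw [inDeg, filter_union, card_union_of_disjoint (disjoint_filter_filter h)]
  rfl

lemma endDeg_union {E F : Finset β} (h : Disjoint E F) (a b : β → α) (v : α) :
    endDeg (E ∪ F) a b v = endDeg E a b v + endDeg F a b v := by
  simp only [endDeg, inDeg_union h]
  omega

lemma inDeg_biUnion {ι : Type*} [Fintype ι] {F : ι → Finset β}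
    (h : Pairwise fun i j ↦ Disjoint (F i) (F j)) (b : β → α) (v : α) :
    inDeg (univ.biUnion F) b v = ∑ i, inDeg (F i) b v := by
  rw [inDeg, filter_biUnion, card_biUnion fun i _ j _ hij ↦ disjoint_filter_filter (h hij)]
  rfl

/-- A theorem of Frank, Lau and Szabó: if at each vertex there are at most as many forbidden
degrees as entering arcs, some set of edges avoids all the forbidden degrees. If the empty set
fails at a vertex `v`, then `0` is forbidden at `v`; an arc `e` into `v` is put into the factor, and
the forbidden degrees at its ends are lowered accordingly, which discards `0` at `v`. -/
theorem exists_endDeg_notMem (a b : β → α) (E : Finset β) (B : α → Finset ℕ)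
    (hB : ∀ v, #(B v) ≤ inDeg E b v) :
    ∃ S ⊆ E, ∀ v, endDeg S a b v ∉ B v := by
  induction E using Finset.strongInduction generalizing B with
  | H E ih =>
    by_cases h₀ : ∀ v, 0 ∉ B v
    · exact ⟨∅, empty_subset E, fun v ↦ by simpa [endDeg, inDeg] using h₀ v⟩
    push Not at h₀
    obtain ⟨w, hw⟩ := h₀
    have hpos : 0 < inDeg E b w := (card_pos.2 ⟨0, hw⟩).trans_le (hB w)
    obtain ⟨e, he⟩ := card_pos.1 hpos
    obtain ⟨heE, rfl⟩ := mem_filter.1 he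
    have hsplit : ∀ S : Finset β, e ∉ S → ∀ c : β → α, ∀ v,
        inDeg (insert e S) c v = inDeg {e} c v + inDeg S c v := fun S hS c v ↦ by
      rw [insert_eq, inDeg_union (disjoint_singleton_left.2 hS)]
    have hsplit' : ∀ S : Finset β, e ∉ S → ∀ v,
        endDeg (insert e S) a b v = endDeg {e} a b v + endDeg S a b v := fun S hS v ↦ by
      rw [insert_eq, endDeg_union (disjoint_singleton_left.2 hS)]
    -- The forbidden degrees at `v` after `e` has been put into the factor.
    let B' : α → Finset ℕ := fun v ↦
      {j ∈ range ((B v).sup id + 1) | endDeg {e} a b v + j ∈ B v}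
    have hB' : ∀ v, #(B' v) ≤ inDeg (E.erase e) b v := by
      intro v
      have hinj : Set.InjOn (fun j ↦ endDeg {e} a b v + j) (B' v) := fun i _ j _ h ↦ by
        simpa using h
      have hv := hB v
      rw [← insert_erase heE, hsplit _ (notMem_erase e E)] at hv
      rw [← card_image_of_injOn hinj]
      rcases eq_or_ne (b e) v with rfl | hne
      · have hone : inDeg {e} b (b e) = 1 := by simp [inDeg, filter_singleton]
        have hsub : (B' (b e)).image (fun j ↦ endDeg {e} a b (b e) + j) ⊆ (B (b e)).erase 0 := by
          intro i hi
          obtain ⟨j, hj, rfl⟩ := mem_image.1 hi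
          refine mem_erase.2 ⟨?_, (mem_filter.1 hj).2⟩
          simp only [endDeg, hone]
          omega
        have h₁ := card_le_card hsub
        rw [card_erase_of_mem hw] at h₁
        omega
      · have hzero : inDeg {e} b v = 0 := by simp [inDeg, filter_singleton, hne]
        have hsub : (B' v).image (fun j ↦ endDeg {e} a b v + j) ⊆ B v := by
          intro i hi
          obtain ⟨j, hj, rfl⟩ := mem_image.1 hi
          exact (mem_filter.1 hj).2
        have h₁ := card_le_card hsub
        omega
    obtain ⟨S, hSE, hS⟩ := ih (E.erase e) (erase_ssubset heE) B' hB'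
    have heS : e ∉ S := fun h ↦ notMem_erase e E (hSE h)
    refine ⟨insert e S, insert_subset heE (hSE.trans (erase_subset e E)), fun v hv ↦ hS v ?_⟩
    rw [hsplit' S heS] at hv
    refine mem_filter.2 ⟨mem_range.2 (Nat.lt_succ_of_le ?_), hv⟩
    exact (Nat.le_add_left _ _).trans (le_sup (f := id) hv)

/-! ### The orientation and the count of forbidden degrees -/

/-- At a vertex of degree `d = dT + dT₀ + dR`, with `dT` and `dT₀` edge ends in the two unions of
spanning trees and `dR` in the remaining edges, this bounds the number of degrees `j ≤ dR` that
the remaining edges must avoid. The list loses at most `dT - m` elements below `dT` and at most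
`dT₀ - m₀` elements above `dT + dR`; both differences may be truncated at the root. -/
lemma card_forbidden_add_le {L : Finset ℕ} {m m₀ d dT dT₀ dR : ℕ} (hd : d = dT + dT₀ + dR)
    (hL : ∀ j ∈ L, m ≤ j ∧ j + m₀ ≤ d) (hcard : d + 2 ≤ 2 * #L) :
    #{j ∈ range (dR + 1) | j + dT ∉ L} + (dT + dT₀) ≤ d / 2 + (dT - m) + (dT₀ - m₀) := by
  have h₁ := card_filter_add_card_filter_not (s := range (dR + 1)) (fun j ↦ j + dT ∈ L)
  rw [card_range] at h₁
  have h₂ : L ⊆ Ico m dT ∪ {j ∈ range (dR + 1) | j + dT ∈ L}.image (· + dT) ∪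
      Ioc (dT + dR) (d - m₀) := by
    intro j hj
    have := hL j hj
    simp only [mem_union, mem_Ico, mem_image, mem_filter, mem_range, mem_Ioc]
    by_cases hlow : j < dT
    · exact .inl (.inl ⟨this.1, hlow⟩)
    by_cases hhigh : dT + dR < j
    · exact .inr ⟨hhigh, by omega⟩
    · exact .inl (.inr ⟨j - dT, ⟨by omega, by rwa [Nat.sub_add_cancel (by omega)]⟩, by omega⟩)
  have h₃ := (card_le_card h₂).trans ((card_union_le _ _).trans
    (add_le_add_left (card_union_le _ _) _))
  have h₄ := card_image_le (s := {j ∈ range (dR + 1) | j + dT ∈ L}) (f := (· + dT))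
  rw [Nat.card_Ico, Nat.card_Ioc] at h₃
  omega

/-- An orientation of a `2k`-edge-connected graph with `k` arc-disjoint spanning arborescences,
in which every vertex receives at least half of its edges, rounded down. -/
theorem exists_orientation_disjoint_isArborescence {V : Finset α} {E : Finset β} {s t : β → α}
    (hs : ∀ e ∈ E, s e ∈ V) (ht : ∀ e ∈ E, t e ∈ V) {k : ℕ} {r : α} (hr : r ∈ V)
    (hcut : ∀ X ⊆ V, X.Nonempty → X ≠ V → 2 * k ≤ #(boundary E s t X)) :
    ∃ a b : β → α, (∀ e, (a e = s e ∧ b e = t e) ∨ (a e = t e ∧ b e = s e)) ∧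
      (∀ v ∈ V, endDeg E a b v / 2 ≤ inDeg E b v) ∧
      ∃ F : Fin k → Finset β, (∀ i, F i ⊆ E) ∧ Pairwise (fun i j ↦ Disjoint (F i) (F j)) ∧
        ∀ i, IsArborescence a b r V (F i) := by
  obtain ⟨o, hodeg, hosum, hole, hor⟩ := exists_inDegree_prescription hs ht hr hcut
  obtain ⟨a, b, hab, hb⟩ := exists_orientation hs ht hosum hole
  have hinside : ∀ X, inside E a b X = inside E s t X := fun X ↦ by
    refine filter_congr fun e _ ↦ ?_
    rcases hab e with ⟨h₁, h₂⟩ | ⟨h₁, h₂⟩ <;> simp [h₁, h₂, and_comm]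
  have hends : ∀ v, endDeg E a b v = endDeg E s t v := fun v ↦ by
    simp only [endDeg, inDeg, card_filter]
    rw [← sum_add_distrib, ← sum_add_distrib]
    refine sum_congr rfl fun e _ ↦ ?_
    rcases hab e with ⟨h₁, h₂⟩ | ⟨h₁, h₂⟩ <;> simp [h₁, h₂, add_comm]
  refine ⟨a, b, hab, fun v hv ↦ ?_, exists_disjoint_isArborescence hr k ?_ ?_ ?_⟩
  · rw [hends, hb v hv]
    exact hodeg v hv
  · intro e he
    rcases hab e with ⟨h, -⟩ | ⟨h, -⟩ <;> rw [h]
    exacts [hs e he, ht e he]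
  · intro e he
    rcases hab e with ⟨-, h⟩ | ⟨-, h⟩ <;> rw [h]
    exacts [ht e he, hs e he]
  · intro X hX hne hrX
    have h₁ := sum_inDeg_eq_card_inside_add_card_entering E a b X
    have h₂ := hor X hX hne hrX
    have h₃ : ∑ v ∈ X, inDeg E b v = ∑ v ∈ X, o v := sum_congr rfl fun v hv ↦ hb v (hX hv)
    rw [hinside] at h₁
    omega

/-! ### From arborescences to spanning trees -/

namespace IsArborescence

variable {a b : β → α} {r : α} {U : Finset α} {F : Finset β}

lemma reflTransGen_adj (h : IsArborescence a b r U F) {K : Graph α β}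
    (hK : ∀ e ∈ F, K.IsLink e (a e) (b e)) : ∀ x ∈ U, Relation.ReflTransGen K.Adj r x := by
  induction h with
  | root => simp [Relation.ReflTransGen.refl]
  | @grow U F e _ ha _ ih =>
    intro x hx
    have ih := ih fun f hf ↦ hK f (mem_insert_of_mem hf)
    rcases mem_insert.1 hx with rfl | hx
    · exact (ih _ ha).tail ⟨e, hK e (mem_insert_self e F)⟩
    · exact ih x hx

/-- A cycle cannot use the last arc that was added, since both cycle edges at its new vertex
would be that arc. -/
lemma not_exists_cycle (h : IsArborescence a b r U F) {n : ℕ} {v : Fin (n + 1) → α}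
    {c : Fin (n + 1) → β} (hc : Function.Injective c) (hF : ∀ i, c i ∈ F)
    (hv : ∀ i, (a (c i) = v i ∧ b (c i) = v (i + 1)) ∨ (a (c i) = v (i + 1) ∧ b (c i) = v i)) :
    False := by
  induction h with
  | root => simpa using hF 0
  | @grow U F e h ha hb ih =>
    by_cases hall : ∀ i, c i ∈ F
    · exact ih hall
    push Not at hall
    obtain ⟨i, hi⟩ := hall
    have hce : ∀ i, v i = b e ∨ v (i + 1) = b e → c i = e := by
      intro i hi
      by_contra hne
      have hmem := h.ends_mem _ ((mem_insert.1 (hF i)).resolve_left hne)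
      rcases hv i with ⟨h₁, h₂⟩ | ⟨h₁, h₂⟩ <;> rcases hi with hi | hi <;> grind
    have hie : c i = e := (mem_insert.1 (hF i)).resolve_right hi
    obtain ⟨j, hj⟩ : ∃ j, v j = b e := by
      rcases hv i with h | h
      · exact ⟨i + 1, by rw [← h.2, hie]⟩
      · exact ⟨i, by rw [← h.2, hie]⟩
    have h₁ := hce j (.inl hj)
    have h₂ := hce (j - 1) (.inr (by rwa [sub_add_cancel]))
    have h₃ : j + 1 = j := by
      conv_rhs => rw [← sub_add_cancel j 1]
      rw [hc (h₂.trans h₁.symm)]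
    have h₄ := hv j
    rw [h₁, h₃, hj] at h₄
    exact hb (by rcases h₄ with h | h <;> exact h.1 ▸ ha)

lemma isTree_restrict {G : Graph α β} (h : IsArborescence a b r U F)
    (hG : ∀ e ∈ F, G.IsLink e (a e) (b e)) (hU : G.vertexSet = U) :
    (G.restrict F).IsTree := by
  refine ⟨⟨⟨r, ?_⟩, fun x hx y hy ↦ ?_⟩, ?_⟩
  · simpa [hU] using h.root_mem
  · rw [Graph.vertexSet_restrict, hU] at hx hy
    have hreach := h.reflTransGen_adj (K := G.restrict F) fun e he ↦ ⟨he, hG e he⟩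
    exact (symm (r := Relation.ReflTransGen _) (hreach x hx)).trans (hreach y hy)
  · rintro ⟨n, v, c, -, hc, hvc⟩
    exact h.not_exists_cycle hc (fun i ↦ (hvc i).1) fun i ↦
      (hG _ (hvc i).1).eq_and_eq_or_eq_and_eq (hvc i).2

end IsArborescence

lemma degree_restrict {G : Graph α β} {a b : β → α} {S : Finset β}
    (hG : ∀ e ∈ S, G.IsLink e (a e) (b e)) (v : α) :
    (G.restrict S).degree v = endDeg S a b v := by
  have h₁ : {e | (G.restrict S).Inc e v} = ↑({e ∈ S | a e = v} ∪ {e ∈ S | b e = v}) := by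
    ext e
    simp only [Graph.restrict_inc, Set.mem_ofPred_eq, mem_coe, mem_union, mem_filter]
    constructor
    · rintro ⟨hinc, he⟩
      rcases hinc.eq_or_eq_of_isLink (hG e he) with h | h <;> simp [he, h]
    · rintro (⟨he, rfl⟩ | ⟨he, rfl⟩)
      exacts [⟨(hG e he).inc_left, he⟩, ⟨(hG e he).inc_right, he⟩]
  have h₂ : {e | (G.restrict S).IsLoopAt e v} = ↑({e ∈ S | a e = v} ∩ {e ∈ S | b e = v}) := by
    ext e
    simp only [Graph.restrict_isLoopAt, Set.mem_ofPred_eq, mem_coe, mem_inter, mem_filter]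
    constructor
    · rintro ⟨hloop, he⟩
      have hl := hloop.eq_of_inc (hG e he).inc_left
      have hr := hloop.eq_of_inc (hG e he).inc_right
      exact ⟨⟨he, hl.symm⟩, ⟨he, hr.symm⟩⟩
    · rintro ⟨⟨he, ha⟩, ⟨-, hb⟩⟩
      refine ⟨?_, he⟩
      have := hG e he
      rwa [ha, hb] at this
  rw [Graph.degree, h₁, h₂, Set.ncard_coe_finset, Set.ncard_coe_finset, card_union_add_card_inter]
  rfl

lemma isTreeConnected_of_isArborescence {G K : Graph α β} {a b : β → α} {r : α} {V : Finset α}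
    {n : ℕ} {F : Fin n → Finset β} (hF : ∀ i, IsArborescence a b r V (F i))
    (hFd : Pairwise fun i j ↦ Disjoint (F i) (F j))
    (hG : ∀ i, ∀ e ∈ F i, G.IsLink e (a e) (b e)) (hV : G.vertexSet = V)
    (hK : K.IsSpanningSubgraph G) (hFK : ∀ i, ↑(F i) ⊆ K.edgeSet) :
    K.IsTreeConnected n := by
  have hlink : ∀ i, ∀ e ∈ F i, K.IsLink e (a e) (b e) := fun i e he ↦
    (hK.le.isLink_iff (hFK i he)).2 (hG i e he)
  refine ⟨fun i ↦ K.restrict (F i), fun i ↦ ⟨⟨Graph.restrict_le, rfl⟩,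
    (hF i).isTree_restrict (hlink i) (hK.vertexSet_eq.trans hV)⟩, fun i j hij ↦ ?_⟩
  exact (disjoint_coe.2 (hFd hij)).mono Set.inter_subset_right Set.inter_subset_right

end EdgeEnds

/-! ### Highly tree-connected list factors -/

open EdgeEnds in
theorem mainTheorem9 {α β : Type*} (G : Graph α β)
    (hne : G.vertexSet.Nonempty) (hV : G.vertexSet.Finite) (hE : G.edgeSet.Finite)
    (m m₀ : ℕ) (hG : G.IsEdgeConnected (2 * m + 2 * m₀))
    (L : α → Finset ℕ)
    (hL : ∀ v ∈ G.vertexSet, ∀ k ∈ L v, m ≤ k ∧ k + m₀ ≤ G.degree v)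
    (hcard : ∀ v ∈ G.vertexSet, ⌈(G.degree v : ℚ) / 2⌉₊ + 1 ≤ (L v).card) :
    ∃ H : Graph α β, H.IsSpanningSubgraph G ∧
      H.IsTreeConnected m ∧
      (∀ v ∈ G.vertexSet, H.degree v ∈ L v) ∧
      (G.deleteEdges H.edgeSet).IsTreeConnected m₀ := by
  classical
  obtain ⟨r, hr⟩ := hne
  lift G.vertexSet to Finset α using hV with V hGV
  lift G.edgeSet to Finset β using hE with E hGE
  have hmemE : ∀ e, e ∈ E ↔ e ∈ G.edgeSet := fun e ↦ by rw [← hGE, Finset.mem_coe]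
  have hends : ∀ e, ∃ p : α × α, e ∈ E → G.IsLink e p.1 p.2 := fun e ↦ by
    by_cases he : e ∈ E
    · obtain ⟨x, y, h⟩ := Graph.exists_isLink_of_mem_edgeSet ((hmemE e).1 he)
      exact ⟨(x, y), fun _ ↦ h⟩
    · exact ⟨(r, r), fun h ↦ absurd h he⟩
  choose p hp using hends
  have hmemV : ∀ v, v ∈ G.vertexSet → v ∈ V := fun v hv ↦ by rwa [← hGV] at hv
  obtain ⟨a, b, hab, hin, F, hFE, hFd, hF⟩ := exists_orientation_disjoint_isArborescence
    (V := V) (E := E) (s := fun e ↦ (p e).1) (t := fun e ↦ (p e).2) (k := m + m₀)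
    (fun e he ↦ hmemV _ (hp e he).left_mem) (fun e he ↦ hmemV _ (hp e he).right_mem) hr
    fun X hXV hXne hX ↦ by
      have hcut : G.cut X ⊆ ↑(boundary E (fun e ↦ (p e).1) (fun e ↦ (p e).2) X) := by
        rintro e ⟨x, y, hxy, hx, hy⟩
        have he := (hmemE e).2 hxy.edge_mem
        simp only [Finset.mem_coe] at hx hy
        simp only [boundary, Finset.coe_filter, Set.mem_ofPred_eq]
        rcases hxy.eq_and_eq_or_eq_and_eq (hp e he) with ⟨rfl, rfl⟩ | ⟨rfl, rfl⟩ <;>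
          simp [he, hx, hy]
      have h₁ := hG X (by
        rw [← hGV, Finset.coe_ssubset]
        exact Finset.ssubset_iff_subset_ne.2 ⟨hXV, hX⟩) (by simpa using hXne)
      have h₂ := Set.ncard_le_ncard hcut (Finset.finite_toSet _)
      rw [Set.ncard_coe_finset] at h₂
      omega
  have hlink : ∀ e ∈ E, G.IsLink e (a e) (b e) := fun e he ↦ by
    rcases hab e with ⟨h₁, h₂⟩ | ⟨h₁, h₂⟩ <;> rw [h₁, h₂]
    exacts [hp e he, (hp e he).symm]
  -- The first `m` arborescences go into the factor and the last `m₀` into its complement.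
  set F₁ : Fin m → Finset β := fun i ↦ F (Fin.castAdd m₀ i) with hF₁
  set F₂ : Fin m₀ → Finset β := fun i ↦ F (Fin.natAdd m i) with hF₂
  have hd₁ : Pairwise fun i j ↦ Disjoint (F₁ i) (F₁ j) := fun i j hij ↦
    hFd fun h ↦ hij (Fin.castAdd_injective m m₀ h)
  have hd₂ : Pairwise fun i j ↦ Disjoint (F₂ i) (F₂ j) := fun i j hij ↦
    hFd fun h ↦ hij (Fin.natAdd_injective m₀ m h)
  have hd₁₂ : ∀ i j, Disjoint (F₁ i) (F₂ j) := fun i j ↦ hFd fun h ↦ by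
    have := congrArg Fin.val h
    simp only [Fin.val_castAdd, Fin.val_natAdd] at this
    omega
  set T := Finset.univ.biUnion F₁ with hT
  set T₀ := Finset.univ.biUnion F₂ with hT₀
  have hTE : T ⊆ E := Finset.biUnion_subset.2 fun i _ ↦ hFE _
  have hT₀E : T₀ ⊆ E := Finset.biUnion_subset.2 fun i _ ↦ hFE _
  have hTT₀ : Disjoint T T₀ := by
    simp only [hT, hT₀, Finset.disjoint_biUnion_left, Finset.disjoint_biUnion_right]
    exact fun j _ i _ ↦ hd₁₂ i j
  set R := E \ (T ∪ T₀) with hR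
  have hRd : Disjoint (T ∪ T₀) R := Finset.disjoint_sdiff
  have hER : T ∪ T₀ ∪ R = E := Finset.union_sdiff_of_subset (Finset.union_subset hTE hT₀E)
  have hdeg : ∀ v, G.degree v = endDeg T a b v + endDeg T₀ a b v + endDeg R a b v := fun v ↦ by
    rw [← endDeg_union hTT₀, ← endDeg_union hRd, hER, ← degree_restrict hlink, hGE,
      Graph.restrict_self]
  -- The degrees to be avoided by the edges that are chosen outside the arborescences.
  let B : α → Finset ℕ := fun v ↦ if v ∈ V then
    {j ∈ Finset.range (endDeg R a b v + 1) | j + endDeg T a b v ∉ L v} else ∅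
  obtain ⟨S, hSR, hS⟩ := exists_endDeg_notMem a b R B fun v ↦ by
    by_cases hv : v ∈ V
    · have h₁ : inDeg E b v = inDeg T b v + inDeg T₀ b v + inDeg R b v := by
        rw [← inDeg_union hTT₀, ← inDeg_union hRd, hER]
      have hc : G.degree v + 2 ≤ 2 * (L v).card := by
        have h₂ := hcard v hv
        have h₃ : (G.degree v : ℚ) ≤ 2 * (⌈(G.degree v : ℚ) / 2⌉₊ : ℚ) := by
          linarith [Nat.le_ceil ((G.degree v : ℚ) / 2)]
        have h₄ : G.degree v ≤ 2 * ⌈(G.degree v : ℚ) / 2⌉₊ := by exact_mod_cast h₃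
        omega
      have h₂ := card_forbidden_add_le (hdeg v) (hL v hv) hc
      have h₃ := hin v hv
      have h₄ : endDeg E a b v = G.degree v := by
        rw [← degree_restrict hlink, hGE, Graph.restrict_self]
      have h₅ : inDeg T b v = m * if v ≠ r then 1 else 0 := by
        rw [hT, inDeg_biUnion hd₁, Finset.sum_congr rfl fun i _ ↦ (hF _).inDeg_eq v]
        simp [hv]
      have h₆ : inDeg T₀ b v = m₀ * if v ≠ r then 1 else 0 := by
        rw [hT₀, inDeg_biUnion hd₂, Finset.sum_congr rfl fun i _ ↦ (hF _).inDeg_eq v]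
        simp [hv]
      have h₇ : inDeg T b v ≤ endDeg T a b v := Nat.le_add_left _ _
      have h₈ : inDeg T₀ b v ≤ endDeg T₀ a b v := Nat.le_add_left _ _
      simp only [B, if_pos hv]
      rw [h₄] at h₃
      -- Away from the root, the arborescences use exactly `m + m₀` of the entering arcs.
      by_cases hvr : v = r
      · simp only [hvr, ne_eq, not_true, if_false, mul_zero] at h₅ h₆
        subst hvr
        omega
      · simp only [ne_eq, hvr, not_false_eq_true, if_true, mul_one] at h₅ h₆
        omega
    · simp [B, hv]
  have hSE : S ⊆ E := hSR.trans Finset.sdiff_subset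
  have hTS : Disjoint T S := (hRd.mono_left Finset.subset_union_left).mono_right hSR
  have hT₀S : Disjoint T₀ S := (hRd.mono_left Finset.subset_union_right).mono_right hSR
  have hTSE : T ∪ S ⊆ E := Finset.union_subset hTE hSE
  have hHE : (G.restrict ↑(T ∪ S)).edgeSet = ↑(T ∪ S) := by
    rw [Graph.edgeSet_restrict, ← hGE]
    exact Set.inter_eq_right.2 (Finset.coe_subset.2 hTSE)
  refine ⟨G.restrict ↑(T ∪ S), ⟨Graph.restrict_le, rfl⟩, ?_, fun v hv ↦ ?_, ?_⟩
  · refine isTreeConnected_of_isArborescence (F := F₁) (fun i ↦ hF _) hd₁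
      (fun i e he ↦ hlink e (hFE _ he)) hGV.symm ⟨Graph.restrict_le, rfl⟩ fun i ↦ ?_
    rw [hHE, Finset.coe_subset]
    exact (Finset.subset_biUnion_of_mem F₁ (Finset.mem_univ i)).trans Finset.subset_union_left
  · have hSv := hS v
    have hle := endDeg_mono hSR a b v
    rw [degree_restrict fun e he ↦ hlink e (hTSE he), endDeg_union hTS]
    simp only [B, if_pos (show v ∈ V from hv), Finset.mem_filter, Finset.mem_range] at hSv
    by_contra hnot
    exact hSv ⟨by omega, by rwa [add_comm]⟩
  · refine isTreeConnected_of_isArborescence (F := F₂) (fun i ↦ hF _) hd₂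
      (fun i e he ↦ hlink e (hFE _ he)) hGV.symm ⟨Graph.deleteEdges_le, rfl⟩ fun i e he ↦ ?_
    have heT₀ : e ∈ T₀ := Finset.mem_biUnion.2 ⟨i, Finset.mem_univ i, he⟩
    rw [Graph.edgeSet_deleteEdges, hHE]
    refine ⟨(hmemE e).1 (hT₀E heT₀), fun h ↦ ?_⟩
    rcases Finset.mem_union.1 (Finset.mem_coe.1 h) with h | h
    · exact Finset.disjoint_left.1 hTT₀ h heT₀
    · exact Finset.disjoint_left.1 hT₀S heT₀ h
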